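/- Let $G$ be a finite connected simple graph, and let $e=\{v_1,v_2\}$ be a bridge of $G$, that is, an edge whose deletion disconnects $G$. Let $G_1$ and $G_2$ be the connected components of $G\setminus e$, with $v_1\in V(G_1)$ and $v_2\in V(G_2)$. Notation. For a connected graph $H$, let $\mathbf d_H$ be its degree vector, $m_H$ its number of edges and $\tau_H$ its number of spanning trees. A $2$-tree spanning forest of $H$ is an acyclic subgraph containing all the vertices of $H$ and having exactly two connected components. Let $F_H=[f^H_{i,j}]$, where $f^H_{i,j}$ is the number of $2$-tree spanning forests of $H$ such that one of the two trees contains $i$ and the other contains $j$, and let $\mathbf f_H^{j}$ be the column of $F_H$ corresponding to vertex $j$. Let $R_H=[r^H_{i,j}]$ be the effective resistance matrix, $r^H_{i,j}=(\mathbf e_i-\mathbf e_j)^TL_H^\dagger(\mathbf e_i-\mathbf e_j)$, where $L_H^\dagger$ is the Moore–Penrose inverse of the Laplacian matrix of $H$ and $\mathbf e_i$ is the standard basis vector of vertex $i$. For $k=1,2$, let $\widehat{\mathbf d}_{G_k}$ be the vector indexed by $V(G)$ that agrees with $\mathbf d_{G_k}$ on $V(G_k)$ and is zero elsewhere. Let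 $\mathbf 1$ be an all-ones vector and $J$ an all-ones matrix. Then $V(G)$ is the disjoint union of $V(G_1)$ and $V(G_2)$ and, labelling the vertices of $G$ in order of $V(G_1)$ and $V(G_2)$, we have \begin{align*} \mathbf d_G&=\widehat{\mathbf d}_{G_1}+\widehat{\mathbf d}_{G_2}+\mathbf e_{v_1}+\mathbf e_{v_2},\\ m_G&=m_{G_1}+m_{G_2}+1,\\ \tau_G&=\tau_{G_1}\tau_{G_2},\\ F_G&=\begin{bmatrix} \tau_{G_2}F_{G_1} & \tau_{G_2}\mathbf f_{G_1}^{v_1}\mathbf 1^T+\tau_{G_1}\mathbf 1(\mathbf f_{G_2}^{v_2})^T+\tau_{G_1}\tau_{G_2}J\\ \tau_{G_1}\mathbf f_{G_2}^{v_2}\mathbf 1^T+\tau_{G_2}\mathbf 1(\mathbf f_{G_1}^{v_1})^T+\tau_{G_1}\tau_{G_2}J & \tau_{G_1}F_{G_2} \end{bmatrix}. \end{align*} Moreover, \begin{align*} \mathbf d_G^TF_G\mathbf d_G={}&\tau_{G_2}\mathbf d_{G_1}^TF_{G_1}\mathbf d_{G_1}+\tau_{G_1}\mathbf d_{G_2}^TF_{G_2}\mathbf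 d_{G_2}+4\tau_{G_2}(m_{G_2}+1)\mathbf d_{G_1}^T\mathbf f_{G_1}^{v_1}\\ &+4\tau_{G_1}(m_{G_1}+1)\mathbf d_{G_2}^T\mathbf f_{G_2}^{v_2}+2\tau_{G_1}\tau_{G_2}(2m_{G_1}+1)(2m_{G_2}+1), \end{align*} and, equivalently, \begin{align*} \mathbf d_G^TR_G\mathbf d_G={}&\mathbf d_{G_1}^TR_{G_1}\mathbf d_{G_1}+\mathbf d_{G_2}^TR_{G_2}\mathbf d_{G_2}+4(m_{G_2}+1)\mathbf d_{G_1}^TR_{G_1}\mathbf e_{v_1}\\ &+4(m_{G_1}+1)\mathbf d_{G_2}^TR_{G_2}\mathbf e_{v_2}+2(2m_{G_1}+1)(2m_{G_2}+1). \end{align*} -/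

import Mathlib

open Matrix

namespace BridgeGraph

/-- The degree vector `d_G`. -/
noncomputable def degVec {V : Type*} [Fintype V] (G : SimpleGraph V) : V → ℝ :=
  open scoped Classical in fun v => (G.degree v : ℝ)

/-- The number of edges `m_G`. -/
noncomputable def edgeCount {V : Type*} (G : SimpleGraph V) : ℕ :=
  G.edgeSet.ncard

/-- `T` is a spanning tree of `G`. A subgraph containing all the vertices of `G` is the same as a
graph on the vertex type of `G` whose edges are edges of `G`. -/
def IsSpanningTree {V : Type*} (G T : SimpleGraph V) : Prop :=
  T ≤ G ∧ T.IsTree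

/-- The number of spanning trees `τ_G`. -/
noncomputable def treeCount {V : Type*} (G : SimpleGraph V) : ℕ :=
  {T : SimpleGraph V | IsSpanningTree G T}.ncard

/-- `T` is a `k`-tree spanning forest of `G`: an acyclic spanning subgraph with exactly `k`
connected components. -/
def IsTreeSpanningForest {V : Type*} (k : ℕ) (G T : SimpleGraph V) : Prop :=
  T ≤ G ∧ T.IsAcyclic ∧ Nat.card T.ConnectedComponent = k

/-- The set `𝓕_G(i; j)` of 2-tree spanning forests of `G` such that one of the two trees contains
`i` and the other one contains `j`. -/
def separatingForests {V : Type*} (G : SimpleGraph V) (i j : V) : Set (SimpleGraph V) :=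
  {T | IsTreeSpanningForest 2 G T ∧ T.connectedComponentMk i ≠ T.connectedComponentMk j}

/-- The matrix `F_G`, whose `(i, j)` entry is the number of 2-tree spanning forests of `G`
separating `i` and `j`. -/
noncomputable def forestMatrix {V : Type*} (G : SimpleGraph V) : Matrix V V ℝ :=
  Matrix.of fun i j => ((separatingForests G i j).ncard : ℝ)

/-- `X` is the Moore-Penrose inverse of the real matrix `A` (the four Penrose equations). -/
structure IsMoorePenrose {m n : Type*} [Fintype m] [Fintype n]
    (A : Matrix m n ℝ) (X : Matrix n m ℝ) : Prop where
  mul_mul_self : A * X * A = A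
  self_mul_mul : X * A * X = X
  symm_left : (A * X)ᵀ = A * X
  symm_right : (X * A)ᵀ = X * A

theorem IsMoorePenrose.unique {m n : Type*} [Fintype m] [Fintype n]
    {A : Matrix m n ℝ} {X Y : Matrix n m ℝ}
    (hX : IsMoorePenrose A X) (hY : IsMoorePenrose A Y) : X = Y := by
  have h1 : A * X = A * Y := by
    calc A * X = (A * X)ᵀ := hX.symm_left.symm
      _ = ((A * Y) * (A * X))ᵀ := by rw [← Matrix.mul_assoc, hY.mul_mul_self]
      _ = (A * X)ᵀ * (A * Y)ᵀ := Matrix.transpose_mul _ _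
      _ = (A * X) * (A * Y) := by rw [hX.symm_left, hY.symm_left]
      _ = A * Y := by rw [← Matrix.mul_assoc, hX.mul_mul_self]
  have h2 : X * A = Y * A := by
    calc X * A = (X * A)ᵀ := hX.symm_right.symm
      _ = ((X * A) * (Y * A))ᵀ := by
        rw [Matrix.mul_assoc X A (Y * A), ← Matrix.mul_assoc A Y A, hY.mul_mul_self]
      _ = (Y * A)ᵀ * (X * A)ᵀ := Matrix.transpose_mul _ _
      _ = (Y * A) * (X * A) := by rw [hX.symm_right, hY.symm_right]
      _ = Y * A := by
        rw [Matrix.mul_assoc Y A (X * A), ← Matrix.mul_assoc A X A, hX.mul_mul_self]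
  calc X = X * A * X := hX.self_mul_mul.symm
    _ = Y * (A * X) := by rw [h2, Matrix.mul_assoc]
    _ = Y * A * Y := by rw [h1, Matrix.mul_assoc]
    _ = Y := hY.self_mul_mul

theorem exists_isMoorePenrose {n : Type*} [Fintype n] {A : Matrix n n ℝ}
    (hA : A.IsHermitian) : ∃ X : Matrix n n ℝ, IsMoorePenrose A X := by
  classical
  obtain ⟨U, D, hU, hD⟩ : ∃ (U : Matrix n n ℝ) (D : n → ℝ), Uᵀ * U = 1 ∧
      A = U * diagonal D * Uᵀ := by
    refine ⟨hA.eigenvectorUnitary, hA.eigenvalues, ?_, ?_⟩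
    · have := Unitary.coe_star_mul_self hA.eigenvectorUnitary
      simpa [Matrix.star_eq_conjTranspose, Matrix.conjTranspose_eq_transpose_of_trivial] using this
    · have := hA.spectral_theorem
      simpa [Unitary.conjStarAlgAut_apply, Matrix.star_eq_conjTranspose,
        Matrix.conjTranspose_eq_transpose_of_trivial, Function.comp_def] using this
  have key : ∀ a b : n → ℝ, (U * diagonal a * Uᵀ) * (U * diagonal b * Uᵀ)
      = U * diagonal (fun i => a i * b i) * Uᵀ := by
    intro a b
    calc _ = U * diagonal a * (Uᵀ * U) * diagonal b * Uᵀ := by simp only [Matrix.mul_assoc]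
      _ = _ := by rw [hU, Matrix.mul_one, Matrix.mul_assoc U, diagonal_mul_diagonal]
  have ht : ∀ a : n → ℝ, (U * diagonal a * Uᵀ)ᵀ = U * diagonal a * Uᵀ := by
    intro a
    simp [Matrix.transpose_mul, Matrix.mul_assoc]
  refine ⟨U * diagonal (fun i => (D i)⁻¹) * Uᵀ, ?_, ?_, ?_, ?_⟩
  · rw [hD, key, key]; simp
  · rw [hD, key, key]; congr 3; funext i
    by_cases h : D i = 0 <;> simp [h]
  · rw [hD, key, ht]
  · rw [hD, key, ht]

theorem exists_laplacianPinv {V : Type*} [Fintype V] (G : SimpleGraph V) :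
    open scoped Classical in ∃ X : Matrix V V ℝ, IsMoorePenrose (G.lapMatrix ℝ) X := by
  classical
  exact exists_isMoorePenrose (G.isHermitian_lapMatrix ℝ)

/-- The Moore-Penrose inverse `L†` of the Laplacian matrix of `G`. -/
noncomputable def laplacianPinv {V : Type*} [Fintype V] (G : SimpleGraph V) : Matrix V V ℝ :=
  Classical.choose (exists_laplacianPinv G)

/-- The effective resistance matrix `R_G`, with entries `(e_i - e_j)ᵀ L† (e_i - e_j)`. -/
noncomputable def resistanceMatrix {V : Type*} [Fintype V] (G : SimpleGraph V) : Matrix V V ℝ :=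
  open scoped Classical in
  Matrix.of fun i j =>
    (Pi.single i (1 : ℝ) - Pi.single j (1 : ℝ)) ⬝ᵥ
      (laplacianPinv G *ᵥ (Pi.single i (1 : ℝ) - Pi.single j (1 : ℝ)))

/-- The labelling of vertices by those of `S₁` followed by those of `S₂`. -/
def blockLabel {V : Type*} (S₁ S₂ : Set V) : S₁ ⊕ S₂ → V :=
  Sum.elim Subtype.val Subtype.val

/-- The vector on all of `V` that agrees with `x` on `S` and vanishes elsewhere; applied to the
degree vector of a graph `H` with vertex set `S` it gives the vector written `d_H` with a hat. -/
noncomputable def hatVec {V : Type*} {S : Set V} (x : S → ℝ) : V → ℝ :=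
  Function.extend Subtype.val x 0

end BridgeGraph

open BridgeGraph

/-! Deleting the bridge leaves exactly two components, so up to relabelling `G` is the `bridgeSum`
of `G₁` and `G₂` (`blockLabel_bijective`, `comap_blockLabel`). Everything is computed for
`bridgeSum` and transported back along this equivalence.

A subgraph of a bridge sum is a pair of subgraphs together with the choice of keeping the bridge or
not (`exists_eq_of_le_bridgeSum`). The choice does not affect acyclicity, and keeping the bridge
lowers the number of components by one. Hence spanning trees are pairs of trees plus the bridge. A
2-tree forest is either a tree and a 2-tree forest joined by the bridge, or two trees without it;
sorting these by which vertices they separate gives the blocks of `F`.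

Resistances are obtained independently of forests: `r i j` is the potential drop of any unit flow
from `i` to `j`, and potentials on a bridge sum are glued from those on the two sides, so
resistances across the bridge add in series (`resistanceMatrix_bridgeSum`).

The resulting block matrices have the same shape, with weights `τ` for forests and `1` for
resistances. Both quadratic identities are therefore instances of
`degVec_dotProduct_fromBlocks_mulVec`. -/

namespace BridgeGraph
open SimpleGraph

/-! ### Bridge sums: reachability, acyclicity, components and subgraphs. -/

section Graph
variable {V W α β : Type*}

/-- The disjoint sum of two graphs, joined by a single edge between `a` and `b`. -/
def bridgeSum (G : SimpleGraph α) (H : SimpleGraph β) (a : α) (b : β) : SimpleGraph (α ⊕ β) :=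
  (G ⊕g H) ⊔ edge (Sum.inl a) (Sum.inr b)

section Adj
variable {G : SimpleGraph α} {H : SimpleGraph β} {a : α} {b : β}

@[simp] lemma bridgeSum_adj_inl {u v : α} :
    (bridgeSum G H a b).Adj (.inl u) (.inl v) ↔ G.Adj u v := by
  simp [bridgeSum, edge_adj]

@[simp] lemma bridgeSum_adj_inr {u v : β} :
    (bridgeSum G H a b).Adj (.inr u) (.inr v) ↔ H.Adj u v := by
  simp [bridgeSum, edge_adj]

@[simp] lemma bridgeSum_adj_inl_inr {u : α} {v : β} :
    (bridgeSum G H a b).Adj (.inl u) (.inr v) ↔ u = a ∧ v = b := by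
  simp [bridgeSum, edge_adj]

@[simp] lemma bridgeSum_adj_inr_inl {u : α} {v : β} :
    (bridgeSum G H a b).Adj (.inr v) (.inl u) ↔ u = a ∧ v = b := by
  rw [adj_comm, bridgeSum_adj_inl_inr]

lemma sum_reachable_inl {u v : α} : (G ⊕g H).Reachable (.inl u) (.inl v) ↔ G.Reachable u v := by
  refine ⟨fun h => ?_, fun h => h.map Embedding.sumInl.toHom⟩
  -- A predicate closed under adjacency: it records reachability on the left and excludes the right
  -- summand altogether.
  let f : α ⊕ β → Prop := Sum.elim (G.Reachable u) fun _ => False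
  have key : ∀ x, (G ⊕g H).Reachable (.inl u) x → f x := by
    intro x hx
    rw [reachable_iff_reflTransGen] at hx
    induction hx with
    | refl => exact Reachable.refl u
    | @tail y z _ hyz ih =>
      rcases y with y | y <;> rcases z with z | z
      · exact Reachable.trans ih (sum_adj_inl.1 hyz).reachable
      · simp at hyz
      · simp at hyz
      · exact ih
  exact key _ h

lemma sum_reachable_inr {u v : β} : (G ⊕g H).Reachable (.inr u) (.inr v) ↔ H.Reachable u v := by
  rw [← sum_reachable_inl (G := H) (H := G)]
  exact (Iso.reachable_iff (φ := (Iso.sumComm : G ⊕g H ≃g H ⊕g G))).symm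

/-- However often a walk crosses the new edge, only the net effect matters: no crossing, or one
crossing in either direction. The degenerate case `u = v` is allowed. -/
lemma reachable_sup_edge_iff {G : SimpleGraph V} {u v x y : V} :
    (G ⊔ edge u v).Reachable x y ↔ G.Reachable x y ∨ (G.Reachable x u ∧ G.Reachable v y) ∨
      (G.Reachable x v ∧ G.Reachable u y) := by
  constructor
  · intro h
    rw [reachable_iff_reflTransGen] at h
    induction h with
    | refl => exact .inl (Reachable.refl x)
    | @tail y z _ hyz ih =>
      rcases hyz with hyz | hyz
      · have := hyz.reachable
        rcases ih with h | ⟨h, h'⟩ | ⟨h, h'⟩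
        · exact .inl (h.trans this)
        · exact .inr (.inl ⟨h, h'.trans this⟩)
        · exact .inr (.inr ⟨h, h'.trans this⟩)
      · rw [edge_adj] at hyz
        obtain ⟨⟨rfl, rfl⟩ | ⟨rfl, rfl⟩, -⟩ := hyz
        · rcases ih with h | ⟨h, h'⟩ | ⟨h, h'⟩
          · exact .inr (.inl ⟨h, .refl _⟩)
          · exact .inr (.inl ⟨h, .refl _⟩)
          · exact .inl h
        · rcases ih with h | ⟨h, h'⟩ | ⟨h, h'⟩
          · exact .inr (.inr ⟨h, .refl _⟩)
          · exact .inl h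
          · exact .inr (.inr ⟨h, .refl _⟩)
  · have hG : ∀ {p q}, G.Reachable p q → (G ⊔ edge u v).Reachable p q :=
      fun h => h.mono le_sup_left
    have huv : (G ⊔ edge u v).Reachable u v := by
      by_cases h : u = v
      · rw [h]
      · exact Adj.reachable (by simp [edge_adj, h])
    rintro (h | ⟨h, h'⟩ | ⟨h, h'⟩)
    · exact hG h
    · exact (hG h).trans (huv.trans (hG h'))
    · exact (hG h).trans (huv.symm.trans (hG h'))

lemma bridgeSum_reachable_inl {u v : α} :
    (bridgeSum G H a b).Reachable (.inl u) (.inl v) ↔ G.Reachable u v := by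
  rw [bridgeSum, reachable_sup_edge_iff, sum_reachable_inl]
  simp [not_reachable_sum_inl_inr]
  exact fun _ h => (not_reachable_sum_inl_inr _ _ h.symm).elim

lemma bridgeSum_reachable_inr {u v : β} :
    (bridgeSum G H a b).Reachable (.inr u) (.inr v) ↔ H.Reachable u v := by
  rw [bridgeSum, reachable_sup_edge_iff, sum_reachable_inr]
  simp [not_reachable_sum_inl_inr]
  exact fun h => (not_reachable_sum_inl_inr _ _ h.symm).elim

lemma bridgeSum_reachable_inl_inr {u : α} {v : β} :
    (bridgeSum G H a b).Reachable (.inl u) (.inr v) ↔ G.Reachable u a ∧ H.Reachable b v := by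
  rw [bridgeSum, reachable_sup_edge_iff, sum_reachable_inr, sum_reachable_inl]
  simp [not_reachable_sum_inl_inr]

end Adj

lemma sum_deleteEdges_inl (G : SimpleGraph α) (H : SimpleGraph β) (u v : α) :
    (G ⊕g H).deleteEdges {s(.inl u, .inl v)} = G.deleteEdges {s(u, v)} ⊕g H := by
  ext (x | x) (y | y) <;> simp [deleteEdges_adj]

lemma sum_deleteEdges_inr (G : SimpleGraph α) (H : SimpleGraph β) (u v : β) :
    (G ⊕g H).deleteEdges {s(.inr u, .inr v)} = G ⊕g H.deleteEdges {s(u, v)} := by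
  ext (x | x) (y | y) <;> simp [deleteEdges_adj]

/-- Acyclic means that every edge is a bridge, and deleting an edge of one summand leaves the other
untouched. -/
lemma sum_isAcyclic {G : SimpleGraph α} {H : SimpleGraph β} :
    (G ⊕g H).IsAcyclic ↔ G.IsAcyclic ∧ H.IsAcyclic := by
  constructor
  · intro h
    exact ⟨h.embedding Embedding.sumInl, h.embedding Embedding.sumInr⟩
  · rintro ⟨hG, hH⟩
    rw [isAcyclic_iff_forall_adj_isBridge] at hG hH ⊢
    rintro (u | u) (v | v) huv
    · rw [isBridge_iff, sum_deleteEdges_inl, sum_reachable_inl, ← isBridge_iff]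
      exact hG (by simpa using huv)
    · simp at huv
    · simp at huv
    · rw [isBridge_iff, sum_deleteEdges_inr, sum_reachable_inr, ← isBridge_iff]
      exact hH (by simpa using huv)

lemma bridgeSum_isAcyclic {G : SimpleGraph α} {H : SimpleGraph β} {a : α} {b : β} :
    (bridgeSum G H a b).IsAcyclic ↔ G.IsAcyclic ∧ H.IsAcyclic := by
  rw [bridgeSum, isAcyclic_add_edge_iff_of_not_reachable _ _ (not_reachable_sum_inl_inr a b),
    sum_isAcyclic]

lemma card_connectedComponent_sum [Finite α] [Finite β] (G : SimpleGraph α) (H : SimpleGraph β) :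
    Nat.card (G ⊕g H).ConnectedComponent =
      Nat.card G.ConnectedComponent + Nat.card H.ConnectedComponent := by
  rw [← Nat.card_sum]
  refine (Nat.card_congr (Equiv.ofBijective (Sum.elim
    (ConnectedComponent.map (Embedding.sumInl (G := G) (H := H)).toHom)
    (ConnectedComponent.map (Embedding.sumInr (G := G) (H := H)).toHom)) ⟨?_, ?_⟩)).symm
  · rintro (c | c) (d | d) h <;> induction c using ConnectedComponent.ind <;>
      induction d using ConnectedComponent.ind
    · exact congrArg _ (ConnectedComponent.sound (sum_reachable_inl.1 (ConnectedComponent.exact h)))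
    · exact (not_reachable_sum_inl_inr _ _ (ConnectedComponent.exact h)).elim
    · exact (not_reachable_sum_inl_inr _ _ (ConnectedComponent.exact h).symm).elim
    · exact congrArg _ (ConnectedComponent.sound (sum_reachable_inr.1 (ConnectedComponent.exact h)))
  · intro c
    induction c using ConnectedComponent.ind with
    | h v =>
      rcases v with v | v
      · exact ⟨.inl (G.connectedComponentMk v), rfl⟩
      · exact ⟨.inr (H.connectedComponentMk v), rfl⟩

/-- The new edge merges the components of `u` and `v` and no others, so the old components except
that of `v` are in bijection with the new ones. -/
lemma card_connectedComponent_sup_edge [Finite V] {G : SimpleGraph V} {u v : V}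
    (h : ¬ G.Reachable u v) :
    Nat.card (G ⊔ edge u v).ConnectedComponent + 1 = Nat.card G.ConnectedComponent := by
  have e : {c : G.ConnectedComponent // c ≠ G.connectedComponentMk v} ≃
      (G ⊔ edge u v).ConnectedComponent := by
    refine Equiv.ofBijective
      (fun c => c.1.map (Hom.ofLE (le_sup_left : G ≤ G ⊔ edge u v))) ⟨?_, ?_⟩
    · rintro ⟨c, hc⟩ ⟨d, hd⟩ hcd
      induction c using ConnectedComponent.ind
      induction d using ConnectedComponent.ind
      rw [Ne, ConnectedComponent.eq] at hc hd
      rcases reachable_sup_edge_iff.1 (ConnectedComponent.exact hcd) with h | h | h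
      · exact Subtype.ext (ConnectedComponent.sound h)
      · exact (hd h.2.symm).elim
      · exact (hc h.1).elim
    · intro c
      induction c using ConnectedComponent.ind with
      | h w =>
        by_cases hw : G.Reachable w v
        · refine ⟨⟨G.connectedComponentMk u, fun h' => h (ConnectedComponent.exact h')⟩, ?_⟩
          exact ConnectedComponent.sound
            (reachable_sup_edge_iff.2 (.inr (.inl ⟨.refl _, hw.symm⟩)))
        · exact ⟨⟨G.connectedComponentMk w, fun h' => hw (ConnectedComponent.exact h')⟩, rfl⟩
  classical
  rw [← Nat.card_congr e, ← Finite.card_option,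
    Nat.card_congr (Equiv.optionSubtypeNe (G.connectedComponentMk v))]

lemma card_connectedComponent_bridgeSum [Finite α] [Finite β] (G : SimpleGraph α)
    (H : SimpleGraph β) (a : α) (b : β) :
    Nat.card (bridgeSum G H a b).ConnectedComponent + 1 =
      Nat.card G.ConnectedComponent + Nat.card H.ConnectedComponent := by
  rw [bridgeSum, card_connectedComponent_sup_edge (not_reachable_sum_inl_inr a b),
    card_connectedComponent_sum]

lemma card_connectedComponent_eq_one_iff {G : SimpleGraph V} :
    Nat.card G.ConnectedComponent = 1 ↔ G.Connected := by
  rw [Nat.card_eq_one_iff_unique]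
  constructor
  · rintro ⟨h, ⟨c⟩⟩
    obtain ⟨v, -⟩ := c.nonempty_supp
    exact { preconnected := fun u w => ConnectedComponent.exact (h.elim _ _), nonempty := ⟨v⟩ }
  · intro h
    exact ⟨h.preconnected.subsingleton_connectedComponent,
      h.nonempty.map G.connectedComponentMk⟩

/-- Puts trees and 2-tree forests on the same footing, so that both are handled by counting
components. -/
lemma isSpanningTree_iff {G T : SimpleGraph V} :
    IsSpanningTree G T ↔ IsTreeSpanningForest 1 G T := by
  rw [IsSpanningTree, IsTreeSpanningForest, isTree_iff, card_connectedComponent_eq_one_iff]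
  tauto

lemma bridgeSum_le_bridgeSum {G T : SimpleGraph α} {H U : SimpleGraph β} {a : α} {b : β} :
    bridgeSum T U a b ≤ bridgeSum G H a b ↔ T ≤ G ∧ U ≤ H := by
  constructor
  · intro h
    exact ⟨fun _ _ hxy => bridgeSum_adj_inl.1 (h (bridgeSum_adj_inl.2 hxy)),
      fun _ _ hxy => bridgeSum_adj_inr.1 (h (bridgeSum_adj_inr.2 hxy))⟩
  · rintro ⟨h₁, h₂⟩ (x | x) (y | y) hxy
    · simpa using h₁ (by simpa using hxy)
    · simpa using hxy
    · simpa using hxy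
    · simpa using h₂ (by simpa using hxy)

lemma sum_le_bridgeSum {G T : SimpleGraph α} {H U : SimpleGraph β} {a : α} {b : β} :
    T ⊕g U ≤ bridgeSum G H a b ↔ T ≤ G ∧ U ≤ H :=
  ⟨fun h => ⟨fun _ _ hxy => bridgeSum_adj_inl.1 (h (sum_adj_inl.2 hxy)),
      fun _ _ hxy => bridgeSum_adj_inr.1 (h (sum_adj_inr.2 hxy))⟩,
    fun h => le_sup_left.trans (bridgeSum_le_bridgeSum.2 h)⟩

/-- The bridge is the only edge between the two sides, so a subgraph is determined by its two
restrictions and by whether it contains the bridge. -/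
lemma exists_eq_of_le_bridgeSum {G : SimpleGraph α} {H : SimpleGraph β} {a : α} {b : β}
    {T : SimpleGraph (α ⊕ β)} (hT : T ≤ bridgeSum G H a b) :
    ∃ (T₁ : SimpleGraph α) (T₂ : SimpleGraph β), T = T₁ ⊕g T₂ ∨ T = bridgeSum T₁ T₂ a b := by
  refine ⟨T.comap Sum.inl, T.comap Sum.inr, ?_⟩
  have h12 : ∀ x y, T.Adj (.inl x) (.inr y) → x = a ∧ y = b := fun x y h =>
    bridgeSum_adj_inl_inr.1 (hT h)
  by_cases hab : T.Adj (.inl a) (.inr b)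
  · right
    ext (x | x) (y | y)
    · simp
    · rw [bridgeSum_adj_inl_inr]
      exact ⟨h12 x y, by rintro ⟨rfl, rfl⟩; exact hab⟩
    · rw [bridgeSum_adj_inr_inl, adj_comm]
      exact ⟨h12 y x, by rintro ⟨rfl, rfl⟩; exact hab⟩
    · simp
  · left
    have h12' : ∀ x y, ¬ T.Adj (.inl x) (.inr y) := fun x y h => by
      obtain ⟨rfl, rfl⟩ := h12 x y h; exact hab h
    ext (x | x) (y | y)
    · simp
    · simpa using h12' x y
    · simpa [adj_comm] using h12' y x
    · simp

lemma bridgeSum_injective (a : α) (b : β) :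
    Function.Injective fun p : SimpleGraph α × SimpleGraph β => bridgeSum p.1 p.2 a b := by
  rintro ⟨T, U⟩ ⟨T', U'⟩ h
  have h' := bridgeSum_le_bridgeSum.1 (le_of_eq h)
  have h'' := bridgeSum_le_bridgeSum.1 (ge_of_eq h)
  exact Prod.ext (le_antisymm h'.1 h''.1) (le_antisymm h'.2 h''.2)

lemma sum_injective :
    Function.Injective fun p : SimpleGraph α × SimpleGraph β => p.1 ⊕g p.2 := by
  rintro ⟨T, U⟩ ⟨T', U'⟩ h
  simp only at h
  refine Prod.ext ?_ ?_
  · ext x y; simp only; rw [← sum_adj_inl (H := U), h, sum_adj_inl]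
  · ext x y; simp only; rw [← sum_adj_inr (G := T), h, sum_adj_inr]

lemma one_le_card_connectedComponent [Finite V] (G : SimpleGraph V) (v : V) :
    1 ≤ Nat.card G.ConnectedComponent :=
  have : Nonempty G.ConnectedComponent := ⟨G.connectedComponentMk v⟩
  Nat.card_pos

lemma two_le_card_connectedComponent [Finite V] {G : SimpleGraph V} {u v : V}
    (h : ¬ G.Reachable u v) : 2 ≤ Nat.card G.ConnectedComponent := by
  have : Nontrivial G.ConnectedComponent :=
    ⟨_, _, fun h' : G.connectedComponentMk u = G.connectedComponentMk v =>
      h (ConnectedComponent.exact h')⟩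
  exact Finite.one_lt_card

/-! ### Spanning trees and separating forests of a bridge sum. -/

section Count
variable [Finite α] [Finite β] (G : SimpleGraph α) (H : SimpleGraph β) (a : α) (b : β)

lemma isTreeSpanningForest_bridgeSum_iff {T : SimpleGraph α} {U : SimpleGraph β} {k : ℕ} :
    IsTreeSpanningForest k (bridgeSum G H a b) (bridgeSum T U a b) ↔
      (T ≤ G ∧ T.IsAcyclic) ∧ (U ≤ H ∧ U.IsAcyclic) ∧
        Nat.card T.ConnectedComponent + Nat.card U.ConnectedComponent = k + 1 := by
  rw [IsTreeSpanningForest, bridgeSum_le_bridgeSum, bridgeSum_isAcyclic,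
    ← card_connectedComponent_bridgeSum T U a b, Nat.add_right_cancel_iff]
  tauto

lemma isTreeSpanningForest_sum_iff {T : SimpleGraph α} {U : SimpleGraph β} {k : ℕ} :
    IsTreeSpanningForest k (bridgeSum G H a b) (T ⊕g U) ↔
      (T ≤ G ∧ T.IsAcyclic) ∧ (U ≤ H ∧ U.IsAcyclic) ∧
        Nat.card T.ConnectedComponent + Nat.card U.ConnectedComponent = k := by
  rw [IsTreeSpanningForest, sum_le_bridgeSum, sum_isAcyclic, card_connectedComponent_sum]
  tauto

/-- The set of spanning trees of a graph. -/
def spanningTrees {V : Type*} (G : SimpleGraph V) : Set (SimpleGraph V) :=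
  {T | IsSpanningTree G T}

/-- Without the bridge there are at least two components; with it, the two component counts add up
to 2, so both are 1. -/
lemma spanningTrees_bridgeSum :
    spanningTrees (bridgeSum G H a b) =
      (fun p : SimpleGraph α × SimpleGraph β => bridgeSum p.1 p.2 a b) ''
        (spanningTrees G ×ˢ spanningTrees H) := by
  ext T
  simp only [spanningTrees, isSpanningTree_iff, Set.mem_ofPred_eq, Set.mem_image, Set.mem_prod,
    Prod.exists]
  constructor
  · intro hT
    obtain ⟨T₁, T₂, rfl | rfl⟩ := exists_eq_of_le_bridgeSum hT.1
    · rw [isTreeSpanningForest_sum_iff] at hT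
      have := one_le_card_connectedComponent T₁ a
      have := one_le_card_connectedComponent T₂ b
      omega
    · rw [isTreeSpanningForest_bridgeSum_iff] at hT
      have := one_le_card_connectedComponent T₁ a
      have := one_le_card_connectedComponent T₂ b
      obtain ⟨⟨h1, h2⟩, ⟨h3, h4⟩, h5⟩ := hT
      exact ⟨T₁, T₂, ⟨⟨h1, h2, by omega⟩, ⟨h3, h4, by omega⟩⟩, rfl⟩
  · rintro ⟨T₁, T₂, ⟨⟨h1, h2, h3⟩, ⟨h4, h5, h6⟩⟩, rfl⟩
    rw [isTreeSpanningForest_bridgeSum_iff]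
    exact ⟨⟨h1, h2⟩, ⟨h4, h5⟩, by omega⟩

lemma treeCount_bridgeSum : treeCount (bridgeSum G H a b) = treeCount G * treeCount H := by
  change (spanningTrees _).ncard = (spanningTrees _).ncard * (spanningTrees _).ncard
  rw [spanningTrees_bridgeSum, Set.ncard_image_of_injective _ (bridgeSum_injective a b),
    Set.ncard_prod]

lemma mem_separatingForests {V : Type*} {G T : SimpleGraph V} {i j : V} :
    T ∈ separatingForests G i j ↔ IsTreeSpanningForest 2 G T ∧ ¬ T.Reachable i j := by
  rw [separatingForests, Set.mem_ofPred_eq, Ne, ConnectedComponent.eq]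

lemma separatingForests_comm {V : Type*} (G : SimpleGraph V) (i j : V) :
    separatingForests G i j = separatingForests G j i := by
  ext T
  rw [mem_separatingForests, mem_separatingForests, reachable_comm]

/-- Separating two vertices on the left already takes two components there. Without the bridge the
right side would add a third, so the bridge is present and the right part is a tree. -/
lemma separatingForests_bridgeSum_inl (i j : α) :
    separatingForests (bridgeSum G H a b) (.inl i) (.inl j) =
      (fun p : SimpleGraph α × SimpleGraph β => bridgeSum p.1 p.2 a b) ''
        (separatingForests G i j ×ˢ spanningTrees H) := by
  ext T
  simp only [spanningTrees, isSpanningTree_iff, Set.mem_ofPred_eq, Set.mem_image, Set.mem_prod,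
    Prod.exists, mem_separatingForests]
  constructor
  · rintro ⟨hT, hij⟩
    obtain ⟨T₁, T₂, rfl | rfl⟩ := exists_eq_of_le_bridgeSum hT.1
    · rw [isTreeSpanningForest_sum_iff] at hT
      rw [sum_reachable_inl] at hij
      have := two_le_card_connectedComponent hij
      have := one_le_card_connectedComponent T₂ b
      omega
    · rw [isTreeSpanningForest_bridgeSum_iff] at hT
      rw [bridgeSum_reachable_inl] at hij
      have := two_le_card_connectedComponent hij
      have := one_le_card_connectedComponent T₂ b
      obtain ⟨⟨h1, h2⟩, ⟨h3, h4⟩, h5⟩ := hT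
      exact ⟨T₁, T₂, ⟨⟨⟨h1, h2, by omega⟩, hij⟩, ⟨h3, h4, by omega⟩⟩, rfl⟩
  · rintro ⟨T₁, T₂, ⟨⟨⟨h1, h2, h3⟩, hij⟩, ⟨h4, h5, h6⟩⟩, rfl⟩
    rw [isTreeSpanningForest_bridgeSum_iff, bridgeSum_reachable_inl]
    exact ⟨⟨⟨h1, h2⟩, ⟨h4, h5⟩, by omega⟩, hij⟩

lemma separatingForests_bridgeSum_inr (i j : β) :
    separatingForests (bridgeSum G H a b) (.inr i) (.inr j) =
      (fun p : SimpleGraph α × SimpleGraph β => bridgeSum p.1 p.2 a b) ''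
        (spanningTrees G ×ˢ separatingForests H i j) := by
  ext T
  simp only [spanningTrees, isSpanningTree_iff, Set.mem_ofPred_eq, Set.mem_image, Set.mem_prod,
    Prod.exists, mem_separatingForests]
  constructor
  · rintro ⟨hT, hij⟩
    obtain ⟨T₁, T₂, rfl | rfl⟩ := exists_eq_of_le_bridgeSum hT.1
    · rw [isTreeSpanningForest_sum_iff] at hT
      rw [sum_reachable_inr] at hij
      have := two_le_card_connectedComponent hij
      have := one_le_card_connectedComponent T₁ a
      omega
    · rw [isTreeSpanningForest_bridgeSum_iff] at hT
      rw [bridgeSum_reachable_inr] at hij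
      have := two_le_card_connectedComponent hij
      have := one_le_card_connectedComponent T₁ a
      obtain ⟨⟨h1, h2⟩, ⟨h3, h4⟩, h5⟩ := hT
      exact ⟨T₁, T₂, ⟨⟨h1, h2, by omega⟩, ⟨⟨h3, h4, by omega⟩, hij⟩⟩, rfl⟩
  · rintro ⟨T₁, T₂, ⟨⟨h1, h2, h3⟩, ⟨⟨h4, h5, h6⟩, hij⟩⟩, rfl⟩
    rw [isTreeSpanningForest_bridgeSum_iff, bridgeSum_reachable_inr]
    exact ⟨⟨⟨h1, h2⟩, ⟨h4, h5⟩, by omega⟩, hij⟩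

/-- A forest containing the bridge connects `i` to `j` unless `i` is cut off from `a` or `j` from
`b`; having two components, it is split on exactly one side. A forest omitting the bridge always
separates them and consists of two trees. -/
lemma separatingForests_bridgeSum_inl_inr (i : α) (j : β) :
    separatingForests (bridgeSum G H a b) (.inl i) (.inr j) =
      (fun p : SimpleGraph α × SimpleGraph β => bridgeSum p.1 p.2 a b) ''
        (separatingForests G i a ×ˢ spanningTrees H ∪ spanningTrees G ×ˢ separatingForests H j b) ∪
      (fun p : SimpleGraph α × SimpleGraph β => p.1 ⊕g p.2) ''
        (spanningTrees G ×ˢ spanningTrees H) := by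
  ext T
  simp only [spanningTrees, isSpanningTree_iff, Set.mem_ofPred_eq, Set.mem_image, Set.mem_prod,
    Prod.exists, mem_separatingForests, Set.mem_union]
  constructor
  · rintro ⟨hT, hij⟩
    obtain ⟨T₁, T₂, rfl | rfl⟩ := exists_eq_of_le_bridgeSum hT.1
    · rw [isTreeSpanningForest_sum_iff] at hT
      have := one_le_card_connectedComponent T₁ a
      have := one_le_card_connectedComponent T₂ b
      obtain ⟨⟨h1, h2⟩, ⟨h3, h4⟩, h5⟩ := hT
      exact .inr ⟨T₁, T₂, ⟨⟨h1, h2, by omega⟩, ⟨h3, h4, by omega⟩⟩, rfl⟩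
    · rw [isTreeSpanningForest_bridgeSum_iff] at hT
      rw [bridgeSum_reachable_inl_inr] at hij
      have := one_le_card_connectedComponent T₁ a
      have := one_le_card_connectedComponent T₂ b
      obtain ⟨⟨h1, h2⟩, ⟨h3, h4⟩, h5⟩ := hT
      refine .inl ⟨T₁, T₂, ?_, rfl⟩
      by_cases hia : T₁.Reachable i a
      · have hbj : ¬ T₂.Reachable j b := fun h => hij ⟨hia, h.symm⟩
        have := two_le_card_connectedComponent hbj
        exact .inr ⟨⟨h1, h2, by omega⟩, ⟨h3, h4, by omega⟩, hbj⟩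
      · have := two_le_card_connectedComponent hia
        exact .inl ⟨⟨⟨h1, h2, by omega⟩, hia⟩, ⟨h3, h4, by omega⟩⟩
  · rintro (⟨T₁, T₂, ⟨⟨⟨h1, h2, h3⟩, hij⟩, ⟨h4, h5, h6⟩⟩ | ⟨⟨h1, h2, h3⟩, ⟨⟨h4, h5, h6⟩, hij⟩⟩, rfl⟩ |
      ⟨T₁, T₂, ⟨⟨h1, h2, h3⟩, ⟨h4, h5, h6⟩⟩, rfl⟩)
    · rw [isTreeSpanningForest_bridgeSum_iff, bridgeSum_reachable_inl_inr]
      exact ⟨⟨⟨h1, h2⟩, ⟨h4, h5⟩, by omega⟩, fun h => hij h.1⟩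
    · rw [isTreeSpanningForest_bridgeSum_iff, bridgeSum_reachable_inl_inr]
      exact ⟨⟨⟨h1, h2⟩, ⟨h4, h5⟩, by omega⟩, fun h => hij h.2.symm⟩
    · rw [isTreeSpanningForest_sum_iff]
      exact ⟨⟨⟨h1, h2⟩, ⟨h4, h5⟩, by omega⟩, not_reachable_sum_inl_inr _ _⟩

lemma ncard_separatingForests_bridgeSum_inl_inr (i : α) (j : β) :
    (separatingForests (bridgeSum G H a b) (.inl i) (.inr j)).ncard =
      (separatingForests G i a).ncard * treeCount H + treeCount G * (separatingForests H j b).ncard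
        + treeCount G * treeCount H := by
  rw [separatingForests_bridgeSum_inl_inr, Set.ncard_union_eq, Set.ncard_image_of_injective _
    (bridgeSum_injective a b), Set.ncard_image_of_injective _ sum_injective, Set.ncard_union_eq,
    Set.ncard_prod, Set.ncard_prod, Set.ncard_prod]
  · rfl
  -- The left part has two components in one family and one in the other.
  · rw [Set.disjoint_left]
    rintro ⟨T, U⟩ ⟨h, -⟩ ⟨h', -⟩
    have h1 := (isSpanningTree_iff.1 h').2.2
    have h2 := h.1.2.2
    simp only at h1 h2
    omega
  -- Only one of the two families contains the bridge.
  · rw [Set.disjoint_left]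
    rintro _ ⟨⟨T, U⟩, -, rfl⟩ ⟨⟨T', U'⟩, -, h⟩
    refine not_adj_sum_inl_inr (G := T') (H := U') a b ?_
    simp only at h
    rw [h]
    simp

lemma forestMatrix_bridgeSum :
    forestMatrix (bridgeSum G H a b) =
      Matrix.fromBlocks
        ((treeCount H : ℝ) • forestMatrix G)
        ((treeCount H : ℝ) • vecMulVec ((forestMatrix G).col a) 1
          + (treeCount G : ℝ) • vecMulVec 1 ((forestMatrix H).col b)
          + ((treeCount G : ℝ) * treeCount H) • Matrix.of (fun _ _ => 1))
        ((treeCount G : ℝ) • vecMulVec ((forestMatrix H).col b) 1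
          + (treeCount H : ℝ) • vecMulVec 1 ((forestMatrix G).col a)
          + ((treeCount G : ℝ) * treeCount H) • Matrix.of (fun _ _ => 1))
        ((treeCount G : ℝ) • forestMatrix H) := by
  ext (i | i) (j | j)
  · simp only [forestMatrix, of_apply, fromBlocks_apply₁₁, Matrix.smul_apply, smul_eq_mul]
    rw [separatingForests_bridgeSum_inl, Set.ncard_image_of_injective _ (bridgeSum_injective a b),
      Set.ncard_prod, Nat.cast_mul, mul_comm]
    rfl
  · simp only [forestMatrix, of_apply, fromBlocks_apply₁₂, Matrix.smul_apply, smul_eq_mul,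
      Matrix.add_apply, vecMulVec_apply, col_apply, Pi.one_apply]
    rw [ncard_separatingForests_bridgeSum_inl_inr]
    push_cast
    ring
  · simp only [forestMatrix, of_apply, fromBlocks_apply₂₁, Matrix.smul_apply, smul_eq_mul,
      Matrix.add_apply, vecMulVec_apply, col_apply, Pi.one_apply]
    rw [separatingForests_comm, ncard_separatingForests_bridgeSum_inl_inr]
    push_cast
    ring
  · simp only [forestMatrix, of_apply, fromBlocks_apply₂₂, Matrix.smul_apply, smul_eq_mul]
    rw [separatingForests_bridgeSum_inr, Set.ncard_image_of_injective _ (bridgeSum_injective a b),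
      Set.ncard_prod, Nat.cast_mul]
    rfl

end Count

/-! ### Invariance of forest counts under relabelling. -/

section Iso

lemma isTreeSpanningForest_comap_iff (e : V ≃ W) {k : ℕ} {G T : SimpleGraph W} :
    IsTreeSpanningForest k (G.comap e) (T.comap e) ↔ IsTreeSpanningForest k G T := by
  have h : T.comap e ≤ G.comap e ↔ T ≤ G := by
    refine ⟨fun h x y hxy => ?_, fun h _ _ hxy => h hxy⟩
    have := @h (e.symm x) (e.symm y) (by simpa using hxy)
    simpa using this
  rw [IsTreeSpanningForest, IsTreeSpanningForest, h, (Iso.comap e T).isAcyclic_iff,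
    Nat.card_congr (Iso.comap e T).connectedComponentEquiv]

lemma treeCount_comap (e : V ≃ W) (G : SimpleGraph W) : treeCount (G.comap e) = treeCount G := by
  refine (Set.ncard_congr' (e.symm.simpleGraph.subtypeEquiv fun T => ?_)).symm
  simp only [isSpanningTree_iff]
  exact (isTreeSpanningForest_comap_iff e).symm

lemma forestMatrix_comap (e : V ≃ W) (G : SimpleGraph W) :
    forestMatrix (G.comap e) = (forestMatrix G).submatrix e e := by
  ext i j
  simp only [forestMatrix, of_apply, submatrix_apply]
  refine congrArg _ (Set.ncard_congr' (e.symm.simpleGraph.subtypeEquiv fun T => ?_)).symm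
  rw [mem_separatingForests, mem_separatingForests]
  refine and_congr (isTreeSpanningForest_comap_iff e).symm (not_congr ?_)
  exact Iso.reachable_iff (φ := Iso.comap e T)

end Iso

end Graph

/-! ### Effective resistance as a potential drop. -/

section Resistance
variable {V W α β : Type*}

/-- The graph Laplacian acting on functions. -/
noncomputable def laplacian [Fintype V] (G : SimpleGraph V) (x : V → ℝ) (u : V) : ℝ :=
  open scoped Classical in ∑ w, if G.Adj u w then x u - x w else 0

lemma laplacian_add [Fintype V] (G : SimpleGraph V) (x y : V → ℝ) :
    laplacian G (x + y) = laplacian G x + laplacian G y := by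
  funext u
  simp only [laplacian, Pi.add_apply, ← Finset.sum_add_distrib]
  refine Finset.sum_congr rfl fun w _ => ?_
  split_ifs <;> ring

lemma lapMatrix_mulVec_eq_laplacian [Fintype V] [DecidableEq V] (G : SimpleGraph V)
    [DecidableRel G.Adj] (x : V → ℝ) : G.lapMatrix ℝ *ᵥ x = laplacian G x := by
  funext u
  rw [lapMatrix_mulVec_apply, degree_eq_sum_if_adj, laplacian, neighborFinset_eq_filter,
    Finset.sum_filter, Finset.sum_mul, ← Finset.sum_sub_distrib]
  refine Finset.sum_congr rfl fun w _ => ?_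
  split_ifs <;> simp

/-- `x` is the potential of a unit current entering `G` at `i` and leaving it at `j`. -/
def IsPotential [Fintype V] (G : SimpleGraph V) (i j : V) (x : V → ℝ) : Prop :=
  open scoped Classical in laplacian G x = Pi.single i 1 - Pi.single j 1

lemma IsPotential.add [Fintype V] {G : SimpleGraph V} {i j k : V} {x y : V → ℝ}
    (hx : IsPotential G i j x) (hy : IsPotential G j k y) : IsPotential G i k (x + y) := by
  rw [IsPotential, laplacian_add, hx, hy, sub_add_sub_cancel]

lemma IsPotential.comap [Fintype V] [Fintype W] (e : V ≃ W) {G : SimpleGraph W} {i j : V}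
    {x : W → ℝ} (hx : IsPotential G (e i) (e j) x) : IsPotential (G.comap e) i j (x ∘ e) := by
  classical
  funext u
  have h := congrFun hx (e u)
  rw [laplacian, ← e.sum_comp] at h
  simpa [laplacian, Pi.single_apply] using h

/-- Since `L x = e_i - e_j` and `L` is symmetric, the resistance is `xᵀ L L† L x = xᵀ L x = x i - x
j`. Any potential will do, with no normalization. -/
lemma IsPotential.resistanceMatrix_eq [Fintype V] {G : SimpleGraph V} {i j : V} {x : V → ℝ}
    (hx : IsPotential G i j x) : resistanceMatrix G i j = x i - x j := by
  classical
  have hP : IsMoorePenrose (G.lapMatrix ℝ) (laplacianPinv G) := by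
    convert! Classical.choose_spec (exists_laplacianPinv G)
  have hL : G.lapMatrix ℝ *ᵥ x = Pi.single i 1 - Pi.single j 1 := by
    rw [lapMatrix_mulVec_eq_laplacian]
    exact hx
  have hS : (G.lapMatrix ℝ)ᵀ = G.lapMatrix ℝ := (G.isSymm_lapMatrix ℝ)
  have h1 : resistanceMatrix G i j =
      (Pi.single i (1 : ℝ) - Pi.single j (1 : ℝ)) ⬝ᵥ
        (laplacianPinv G *ᵥ (Pi.single i (1 : ℝ) - Pi.single j (1 : ℝ))) := by
    rw [resistanceMatrix, of_apply]
  have h2 : ∀ w, (G.lapMatrix ℝ *ᵥ x) ⬝ᵥ w = x ⬝ᵥ (G.lapMatrix ℝ *ᵥ w) := fun w => by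
    rw [dotProduct_mulVec, ← mulVec_transpose, hS]
  rw [h1, ← hL, h2, mulVec_mulVec, mulVec_mulVec, hP.mul_mul_self, hL]
  simp [dotProduct_sub]

/-- The residual `z = y - L X y` lies in the kernel of `L`, which consists of constants because `G`
is connected. Both `y` and the range of `L` have zero sum, so `z = 0` and `X y` is a potential. -/
lemma exists_isPotential [Fintype V] {G : SimpleGraph V} (hG : G.Connected) (i j : V) :
    ∃ x, IsPotential G i j x := by
  classical
  obtain ⟨X, hX⟩ := exists_isMoorePenrose (G.isHermitian_lapMatrix ℝ)
  set L := G.lapMatrix ℝ with hLdef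
  set y : V → ℝ := Pi.single i 1 - Pi.single j 1 with hy
  have hS : Lᵀ = L := G.isSymm_lapMatrix ℝ
  have hsum : ∀ z : V → ℝ, ∑ u, (L *ᵥ z) u = 0 := by
    intro z
    have h1 : L *ᵥ (1 : V → ℝ) = 0 := G.lapMatrix_mulVec_const_eq_zero
    rw [← one_dotProduct, dotProduct_mulVec, ← mulVec_transpose, hS, h1, zero_dotProduct]
  -- Transpose of `L X L = L`, using that `L` and `L X` are symmetric.
  have hLLX : L * (L * X) = L := by
    rw [← hX.symm_left, ← hS, ← transpose_mul, hS, hX.mul_mul_self, hS]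
  set z := y - (L * X) *ᵥ y with hz
  have hLz : L *ᵥ z = 0 := by
    rw [hz, mulVec_sub, mulVec_mulVec, hLLX, sub_self]
  have hconst : ∀ u, z u = z i := fun u =>
    (lapMatrix_mulVec_eq_zero_iff_forall_reachable G).1 hLz u i (hG.preconnected u i)
  have hzsum : ∑ u, z u = 0 := by
    simp only [hz, Pi.sub_apply, Finset.sum_sub_distrib, ← mulVec_mulVec, hsum]
    simp [hy]
  have hzi : z i = 0 := by
    have hV : (Fintype.card V : ℝ) ≠ 0 := by
      have : Nonempty V := ⟨i⟩
      exact_mod_cast Fintype.card_ne_zero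
    simp only [hconst, Finset.sum_const, Finset.card_univ, nsmul_eq_mul] at hzsum
    exact (mul_eq_zero.1 hzsum).resolve_left hV
  refine ⟨X *ᵥ y, ?_⟩
  have : L *ᵥ (X *ᵥ y) = y := by
    have : z = 0 := funext fun u => (hconst u).trans hzi
    rw [mulVec_mulVec]
    exact (sub_eq_zero.1 this).symm
  rw [hLdef, lapMatrix_mulVec_eq_laplacian] at this
  rw [IsPotential, this, hy]

lemma resistanceMatrix_self [Fintype V] (G : SimpleGraph V) (i : V) :
    resistanceMatrix G i i = 0 := by
  simp [resistanceMatrix]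

lemma resistanceMatrix_comm [Fintype V] (G : SimpleGraph V) (i j : V) :
    resistanceMatrix G i j = resistanceMatrix G j i := by
  classical
  simp only [resistanceMatrix, of_apply]
  rw [← neg_sub, mulVec_neg, neg_dotProduct_neg]

lemma resistanceMatrix_comap [Fintype V] [Fintype W] (e : V ≃ W) {G : SimpleGraph W}
    (hG : G.Connected) :
    resistanceMatrix (G.comap e) = (resistanceMatrix G).submatrix e e := by
  ext i j
  obtain ⟨x, hx⟩ := exists_isPotential hG (e i) (e j)
  rw [submatrix_apply, hx.resistanceMatrix_eq, (hx.comap e).resistanceMatrix_eq]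
  rfl

/-! ### Potentials and resistances on a bridge sum. -/

section BridgeSum
variable [Fintype α] [Fintype β] {G : SimpleGraph α} {H : SimpleGraph β} {a : α} {b : β}

lemma laplacian_bridgeSum_inl (x : α → ℝ) (y : β → ℝ) (u : α) :
    open scoped Classical in
    laplacian (bridgeSum G H a b) (Sum.elim x y) (.inl u) =
      laplacian G x u + if u = a then x a - y b else 0 := by
  classical
  simp only [laplacian, Fintype.sum_sum_type, Sum.elim_inl, Sum.elim_inr, bridgeSum_adj_inl,
    bridgeSum_adj_inl_inr]
  congr 1
  by_cases h : u = a <;> simp [h]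

lemma laplacian_bridgeSum_inr (x : α → ℝ) (y : β → ℝ) (u : β) :
    open scoped Classical in
    laplacian (bridgeSum G H a b) (Sum.elim x y) (.inr u) =
      laplacian H y u + if u = b then y b - x a else 0 := by
  classical
  simp only [laplacian, Fintype.sum_sum_type, Sum.elim_inl, Sum.elim_inr, bridgeSum_adj_inr,
    bridgeSum_adj_inr_inl]
  rw [add_comm]
  congr 1
  by_cases h : u = b <;> simp [h]

lemma laplacian_const [Fintype V] (G : SimpleGraph V) (c : ℝ) : laplacian G (fun _ => c) = 0 := by
  funext u
  simp [laplacian]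

/-- Extending by the constant `x a` makes the drop across the bridge zero, so no current enters the
other side. -/
lemma IsPotential.bridgeSum_inl {i j : α} {x : α → ℝ} (hx : IsPotential G i j x) :
    IsPotential (bridgeSum G H a b) (.inl i) (.inl j) (Sum.elim x fun _ => x a) := by
  classical
  funext u
  rcases u with u | u
  · rw [laplacian_bridgeSum_inl, hx]
    simp [Pi.single_apply]
  · rw [laplacian_bridgeSum_inr, laplacian_const]
    simp

lemma IsPotential.bridgeSum_inr {i j : β} {y : β → ℝ} (hy : IsPotential H i j y) :
    IsPotential (bridgeSum G H a b) (.inr i) (.inr j) (Sum.elim (fun _ => y b) y) := by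
  classical
  funext u
  rcases u with u | u
  · rw [laplacian_bridgeSum_inl, laplacian_const]
    simp
  · rw [laplacian_bridgeSum_inr, hy]
    simp [Pi.single_apply]

lemma isPotential_bridgeSum_bridge :
    IsPotential (bridgeSum G H a b) (.inl a) (.inr b) (Sum.elim (fun _ => 1) fun _ => 0) := by
  classical
  funext u
  rcases u with u | u
  · rw [laplacian_bridgeSum_inl, laplacian_const]
    simp [Pi.single_apply]
  · rw [laplacian_bridgeSum_inr, laplacian_const]
    by_cases h : u = b <;> simp [h]

lemma resistanceMatrix_bridgeSum_inl_inr (hG : G.Connected) (hH : H.Connected) (i : α) (j : β) :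
    resistanceMatrix (bridgeSum G H a b) (.inl i) (.inr j) =
      resistanceMatrix G i a + resistanceMatrix H j b + 1 := by
  obtain ⟨x, hx⟩ := exists_isPotential hG i a
  obtain ⟨y, hy⟩ := exists_isPotential hH b j
  -- Unit flows from `i` to `a`, across the bridge, and from `b` to `j` are superposed; the sources
  -- and sinks at `a` and `b` cancel.
  rw [((hx.bridgeSum_inl.add isPotential_bridgeSum_bridge).add
    hy.bridgeSum_inr).resistanceMatrix_eq, resistanceMatrix_comm H, hx.resistanceMatrix_eq,
    hy.resistanceMatrix_eq]
  simp only [Pi.add_apply, Sum.elim_inl, Sum.elim_inr]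
  ring

lemma resistanceMatrix_bridgeSum (hG : G.Connected) (hH : H.Connected) :
    resistanceMatrix (bridgeSum G H a b) =
      Matrix.fromBlocks (resistanceMatrix G)
        (vecMulVec ((resistanceMatrix G).col a) 1 + vecMulVec 1 ((resistanceMatrix H).col b)
          + Matrix.of (fun _ _ => 1))
        (vecMulVec ((resistanceMatrix H).col b) 1 + vecMulVec 1 ((resistanceMatrix G).col a)
          + Matrix.of (fun _ _ => 1))
        (resistanceMatrix H) := by
  ext (i | i) (j | j)
  · obtain ⟨x, hx⟩ := exists_isPotential hG i j
    rw [fromBlocks_apply₁₁, hx.resistanceMatrix_eq, hx.bridgeSum_inl.resistanceMatrix_eq]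
    rfl
  · rw [resistanceMatrix_bridgeSum_inl_inr hG hH]
    simp
  · rw [resistanceMatrix_comm, resistanceMatrix_bridgeSum_inl_inr hG hH]
    simp
    ring
  · obtain ⟨x, hx⟩ := exists_isPotential hH i j
    rw [fromBlocks_apply₂₂, hx.resistanceMatrix_eq, hx.bridgeSum_inr.resistanceMatrix_eq]
    rfl

end BridgeSum

end Resistance

/-! ### Degree vectors and the block quadratic form. -/

section QuadraticForm
variable {V W α β : Type*}

lemma sum_degVec [Fintype V] (G : SimpleGraph V) : ∑ v, degVec G v = 2 * edgeCount G := by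
  classical
  have h := G.sum_degrees_eq_twice_card_edges
  have h2 : edgeCount G = G.edgeFinset.card := by
    rw [edgeCount, ← coe_edgeFinset, Set.ncard_coe_finset]
  rw [h2]
  simp only [degVec]
  exact_mod_cast h

lemma degVec_eq_sum [Fintype V] (G : SimpleGraph V) (v : V) :
    open scoped Classical in degVec G v = ∑ w, if G.Adj v w then 1 else 0 := by
  rw [degVec, degree_eq_sum_if_adj]

lemma degVec_comap [Fintype V] [Fintype W] (e : V ≃ W) (G : SimpleGraph W) :
    degVec (G.comap e) = degVec G ∘ e := by
  classical
  funext v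
  rw [Function.comp_apply, degVec_eq_sum, degVec_eq_sum, ← e.sum_comp]
  simp

lemma degVec_bridgeSum [Fintype α] [Fintype β] [DecidableEq α] [DecidableEq β]
    (G : SimpleGraph α) (H : SimpleGraph β) (a : α) (b : β) :
    degVec (bridgeSum G H a b) =
      Sum.elim (degVec G + Pi.single a 1) (degVec H + Pi.single b 1) := by
  classical
  funext u
  rcases u with u | u
  · rw [degVec_eq_sum, Fintype.sum_sum_type]
    simp only [bridgeSum_adj_inl, bridgeSum_adj_inl_inr, Sum.elim_inl, Pi.add_apply, degVec_eq_sum]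
    by_cases h : u = a <;> simp [h]
  · rw [degVec_eq_sum, Fintype.sum_sum_type, add_comm]
    simp only [bridgeSum_adj_inr, bridgeSum_adj_inr_inl, Sum.elim_inr, Pi.add_apply, degVec_eq_sum]
    by_cases h : u = b <;> simp [h]

lemma dotProduct_mulVec_comp_equiv [Fintype V] [Fintype W] (e : V ≃ W) (M : Matrix W W ℝ)
    (x : W → ℝ) : (x ∘ e) ⬝ᵥ (M.submatrix e e *ᵥ (x ∘ e)) = x ⬝ᵥ (M *ᵥ x) := by
  rw [submatrix_mulVec_equiv, Function.comp_assoc, Equiv.self_comp_symm, Function.comp_id,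
    comp_equiv_dotProduct_comp_equiv]

/-- The two cross terms agree by symmetry at `a`, and the term quadratic in the added unit vector is
the zero diagonal entry. -/
lemma dotProduct_mulVec_add_single [Fintype α] [DecidableEq α] {A : Matrix α α ℝ} {a : α}
    (hA : ∀ i, A a i = A i a) (ha : A a a = 0) (x : α → ℝ) :
    (x + Pi.single a 1) ⬝ᵥ (A *ᵥ (x + Pi.single a 1)) = x ⬝ᵥ (A *ᵥ x) + 2 * (x ⬝ᵥ A.col a) := by
  have h1 : (A *ᵥ x) a = x ⬝ᵥ A.col a := by
    rw [mulVec, dotProduct_comm]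
    exact congrArg _ (funext hA)
  rw [mulVec_add, mulVec_single_one, add_dotProduct, dotProduct_add, dotProduct_add,
    single_one_dotProduct, single_one_dotProduct, h1, col_apply, ha]
  ring

lemma dotProduct_fromBlocks_mulVec [Fintype α] [Fintype β] (A : Matrix α α ℝ)
    (B : Matrix β β ℝ) (f : α → ℝ) (g : β → ℝ) (s t : ℝ) (x : α → ℝ) (y : β → ℝ) :
    Sum.elim x y ⬝ᵥ (Matrix.fromBlocks (t • A)
        (t • vecMulVec f 1 + s • vecMulVec 1 g + (s * t) • Matrix.of (fun _ _ => 1))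
        (s • vecMulVec g 1 + t • vecMulVec 1 f + (s * t) • Matrix.of (fun _ _ => 1))
        (s • B) *ᵥ Sum.elim x y) =
      t * (x ⬝ᵥ (A *ᵥ x)) + s * (y ⬝ᵥ (B *ᵥ y)) +
        2 * (t * (x ⬝ᵥ f) * (∑ j, y j) + s * (∑ i, x i) * (y ⬝ᵥ g)
          + s * t * (∑ i, x i) * (∑ j, y j)) := by
  have h₁₂ : Matrix.of (fun (_ : α) (_ : β) => (1 : ℝ)) = vecMulVec 1 1 := by
    ext; simp [vecMulVec_apply]
  have h₂₁ : Matrix.of (fun (_ : β) (_ : α) => (1 : ℝ)) = vecMulVec 1 1 := by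
    ext; simp [vecMulVec_apply]
  rw [fromBlocks_mulVec, h₁₂, h₂₁, sumElim_dotProduct_sumElim]
  simp only [Function.comp_def, Sum.elim_inl, Sum.elim_inr, add_mulVec, smul_mulVec,
    vecMulVec_mulVec, dotProduct_add, dotProduct_smul, op_smul_eq_smul, smul_eq_mul,
    one_dotProduct, dotProduct_one]
  rw [dotProduct_comm f x, dotProduct_comm g y]
  ring

/-- The block quadratic form evaluated at the degree vector of a bridge sum. -/
lemma degVec_dotProduct_fromBlocks_mulVec [Fintype α] [Fintype β] [DecidableEq α] [DecidableEq β]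
    (G : SimpleGraph α) (H : SimpleGraph β) {a : α} {b : β} {A : Matrix α α ℝ} {B : Matrix β β ℝ}
    (hA : ∀ i, A a i = A i a) (ha : A a a = 0) (hB : ∀ i, B b i = B i b) (hb : B b b = 0)
    (s t : ℝ) :
    degVec (bridgeSum G H a b) ⬝ᵥ (Matrix.fromBlocks (t • A)
        (t • vecMulVec (A.col a) 1 + s • vecMulVec 1 (B.col b)
          + (s * t) • Matrix.of (fun _ _ => 1))
        (s • vecMulVec (B.col b) 1 + t • vecMulVec 1 (A.col a)
          + (s * t) • Matrix.of (fun _ _ => 1))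
        (s • B) *ᵥ degVec (bridgeSum G H a b)) =
      t * (degVec G ⬝ᵥ (A *ᵥ degVec G)) + s * (degVec H ⬝ᵥ (B *ᵥ degVec H))
        + 4 * t * (edgeCount H + 1) * (degVec G ⬝ᵥ A.col a)
        + 4 * s * (edgeCount G + 1) * (degVec H ⬝ᵥ B.col b)
        + 2 * s * t * (2 * edgeCount G + 1) * (2 * edgeCount H + 1) := by
  -- The coefficient `4 (m + 1)` is `2 + 2 (2 m + 1)`: the unit vector added to the degrees in the
  -- diagonal block contributes 2, and the off-diagonal blocks contribute twice the degree sum `2 m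
  -- + 1` of the other side.
  rw [degVec_bridgeSum, dotProduct_fromBlocks_mulVec, dotProduct_mulVec_add_single hA ha,
    dotProduct_mulVec_add_single hB hb, add_dotProduct, add_dotProduct, single_one_dotProduct,
    single_one_dotProduct, col_apply, col_apply, ha, hb]
  simp only [Pi.add_apply, Finset.sum_add_distrib, sum_degVec, Finset.sum_pi_single',
    Finset.mem_univ, if_true]
  ring

lemma forestMatrix_comm (G : SimpleGraph V) (i j : V) :
    forestMatrix G i j = forestMatrix G j i := by
  simp only [forestMatrix, of_apply, separatingForests_comm G i j]

lemma forestMatrix_self (G : SimpleGraph V) (i : V) : forestMatrix G i i = 0 := by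
  have : separatingForests G i i = ∅ := by
    ext T
    simp [mem_separatingForests]
  simp [forestMatrix, this]

end QuadraticForm

/-! ### A graph with a bridge is a bridge sum. -/

section Bridge
variable {V : Type*} {G : SimpleGraph V} {v₁ v₂ : V}
  {C₁ C₂ : (G.deleteEdges {s(v₁, v₂)}).ConnectedComponent}

/-- For surjectivity, follow a walk in `G` from `v₁`: an edge other than the bridge stays inside its
component of the deleted graph, and the bridge only leads between `v₁` and `v₂`. Injectivity holds
because the bridge property makes the two components distinct. -/
lemma blockLabel_bijective (hG : G.Connected) (hbridge : G.IsBridge s(v₁, v₂))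
    (hv₁ : v₁ ∈ C₁.supp) (hv₂ : v₂ ∈ C₂.supp) :
    Function.Bijective (blockLabel C₁.supp C₂.supp) := by
  have hne : C₁ ≠ C₂ := by
    rintro rfl
    exact hbridge (C₁.reachable_of_mem_supp hv₁ hv₂)
  constructor
  · rintro (⟨x, hx⟩ | ⟨x, hx⟩) (⟨y, hy⟩ | ⟨y, hy⟩) (rfl : x = y)
    · rfl
    · exact (hne (ConnectedComponent.eq_of_common_vertex hx hy)).elim
    · exact (hne (ConnectedComponent.eq_of_common_vertex hy hx)).elim
    · rfl
  · intro x
    suffices h : x ∈ C₁.supp ∨ x ∈ C₂.supp by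
      rcases h with h | h
      · exact ⟨.inl ⟨x, h⟩, rfl⟩
      · exact ⟨.inr ⟨x, h⟩, rfl⟩
    have h := hG.preconnected v₁ x
    rw [reachable_iff_reflTransGen] at h
    induction h with
    | refl => exact .inl hv₁
    | @tail y z _ hyz ih =>
      by_cases he : s(y, z) = s(v₁, v₂)
      · rcases Sym2.eq_iff.1 he with ⟨rfl, rfl⟩ | ⟨rfl, rfl⟩
        · exact .inr hv₂
        · exact .inl hv₁
      · have hadj : (G.deleteEdges {s(v₁, v₂)}).Adj y z := by
          simpa [deleteEdges_adj, hyz] using he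
        exact ih.imp (C₁.mem_supp_congr_adj hadj).1 (C₂.mem_supp_congr_adj hadj).1

lemma comap_blockLabel (hadj : G.Adj v₁ v₂) (hbridge : G.IsBridge s(v₁, v₂))
    (hv₁ : v₁ ∈ C₁.supp) (hv₂ : v₂ ∈ C₂.supp) :
    G.comap (blockLabel C₁.supp C₂.supp) =
      bridgeSum C₁.toSimpleGraph C₂.toSimpleGraph ⟨v₁, hv₁⟩ ⟨v₂, hv₂⟩ := by
  have hne : C₁ ≠ C₂ := by
    rintro rfl
    exact hbridge (C₁.reachable_of_mem_supp hv₁ hv₂)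
  have h₁ : v₂ ∉ C₁.supp := fun h => hne (ConnectedComponent.eq_of_common_vertex h hv₂)
  have h₂ : v₁ ∉ C₂.supp := fun h => hne (ConnectedComponent.eq_of_common_vertex hv₁ h)
  have cross : ∀ x ∈ C₁.supp, ∀ y ∈ C₂.supp, G.Adj x y ↔ x = v₁ ∧ y = v₂ := by
    intro x hx y hy
    refine ⟨fun h => ?_, by rintro ⟨rfl, rfl⟩; exact hadj⟩
    by_cases he : s(x, y) = s(v₁, v₂)
    · rcases Sym2.eq_iff.1 he with h | ⟨rfl, rfl⟩
      · exact h
      · exact (h₁ hx).elim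
    · have hadj : (G.deleteEdges {s(v₁, v₂)}).Adj x y := by
        simpa [deleteEdges_adj, h] using he
      exact (hne (ConnectedComponent.eq_of_common_vertex
        ((C₁.mem_supp_congr_adj hadj).1 hx) hy)).elim
  ext (⟨x, hx⟩ | ⟨x, hx⟩) (⟨y, hy⟩ | ⟨y, hy⟩)
  · rw [bridgeSum_adj_inl, C₁.toSimpleGraph_adj hx hy]
    have : s(x, y) ≠ s(v₁, v₂) := fun he => by
      rcases Sym2.eq_iff.1 he with ⟨rfl, rfl⟩ | ⟨rfl, rfl⟩
      exacts [h₁ hy, h₁ hx]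
    simpa [blockLabel, deleteEdges_adj] using fun _ => this
  · rw [bridgeSum_adj_inl_inr]
    simpa [blockLabel] using cross x hx y hy
  · rw [bridgeSum_adj_inr_inl, adj_comm]
    simpa [blockLabel] using cross y hy x hx
  · rw [bridgeSum_adj_inr, C₂.toSimpleGraph_adj hx hy]
    have : s(x, y) ≠ s(v₁, v₂) := fun he => by
      rcases Sym2.eq_iff.1 he with ⟨rfl, rfl⟩ | ⟨rfl, rfl⟩
      exacts [h₂ hx, h₂ hy]
    simpa [blockLabel, deleteEdges_adj] using fun _ => this

lemma hatVec_apply {S : Set V} (x : S → ℝ) (v : S) : hatVec x v = x v :=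
  Subtype.val_injective.extend_apply _ _ _

lemma hatVec_apply_of_notMem {S : Set V} (x : S → ℝ) {v : V} (hv : v ∉ S) : hatVec x v = 0 :=
  Function.extend_apply' _ _ _ (by rintro ⟨w, rfl⟩; exact hv w.2)

end Bridge

end BridgeGraph

theorem proposition2p1 {V : Type*} [Fintype V] [DecidableEq V]
    (G : SimpleGraph V) (hG : G.Connected) (v₁ v₂ : V)
    (hadj : G.Adj v₁ v₂) (hbridge : G.IsBridge s(v₁, v₂))
    (C₁ C₂ : (G.deleteEdges {s(v₁, v₂)}).ConnectedComponent)
    [Fintype C₁.supp] [Fintype C₂.supp] (hv₁ : v₁ ∈ C₁.supp) (hv₂ : v₂ ∈ C₂.supp)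
    (G₁ : SimpleGraph C₁.supp) (hG₁ : G₁ = C₁.toSimpleGraph)
    (G₂ : SimpleGraph C₂.supp) (hG₂ : G₂ = C₂.toSimpleGraph) :
    degVec G = hatVec (degVec G₁) + hatVec (degVec G₂) + Pi.single v₁ 1 + Pi.single v₂ 1 ∧
    edgeCount G = edgeCount G₁ + edgeCount G₂ + 1 ∧
    treeCount G = treeCount G₁ * treeCount G₂ ∧
    Function.Bijective (blockLabel C₁.supp C₂.supp) ∧
    (forestMatrix G).submatrix (blockLabel C₁.supp C₂.supp) (blockLabel C₁.supp C₂.supp) =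
      Matrix.fromBlocks
        ((treeCount G₂ : ℝ) • forestMatrix G₁)
        ((treeCount G₂ : ℝ) • vecMulVec ((forestMatrix G₁).col ⟨v₁, hv₁⟩) 1
          + (treeCount G₁ : ℝ) • vecMulVec 1 ((forestMatrix G₂).col ⟨v₂, hv₂⟩)
          + ((treeCount G₁ : ℝ) * treeCount G₂) • Matrix.of (fun _ _ => 1))
        ((treeCount G₁ : ℝ) • vecMulVec ((forestMatrix G₂).col ⟨v₂, hv₂⟩) 1
          + (treeCount G₂ : ℝ) • vecMulVec 1 ((forestMatrix G₁).col ⟨v₁, hv₁⟩)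
          + ((treeCount G₁ : ℝ) * treeCount G₂) • Matrix.of (fun _ _ => 1))
        ((treeCount G₁ : ℝ) • forestMatrix G₂) ∧
    degVec G ⬝ᵥ (forestMatrix G *ᵥ degVec G) =
      treeCount G₂ * (degVec G₁ ⬝ᵥ (forestMatrix G₁ *ᵥ degVec G₁))
        + treeCount G₁ * (degVec G₂ ⬝ᵥ (forestMatrix G₂ *ᵥ degVec G₂))
        + 4 * treeCount G₂ * (edgeCount G₂ + 1)
          * (degVec G₁ ⬝ᵥ (forestMatrix G₁).col ⟨v₁, hv₁⟩)
        + 4 * treeCount G₁ * (edgeCount G₁ + 1)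
          * (degVec G₂ ⬝ᵥ (forestMatrix G₂).col ⟨v₂, hv₂⟩)
        + 2 * treeCount G₁ * treeCount G₂ * (2 * edgeCount G₁ + 1) * (2 * edgeCount G₂ + 1) ∧
    degVec G ⬝ᵥ (resistanceMatrix G *ᵥ degVec G) =
      degVec G₁ ⬝ᵥ (resistanceMatrix G₁ *ᵥ degVec G₁)
        + degVec G₂ ⬝ᵥ (resistanceMatrix G₂ *ᵥ degVec G₂)
        + 4 * (edgeCount G₂ + 1)
          * (degVec G₁ ⬝ᵥ (resistanceMatrix G₁ *ᵥ Pi.single ⟨v₁, hv₁⟩ 1))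
        + 4 * (edgeCount G₁ + 1)
          * (degVec G₂ ⬝ᵥ (resistanceMatrix G₂ *ᵥ Pi.single ⟨v₂, hv₂⟩ 1))
        + 2 * (2 * edgeCount G₁ + 1) * (2 * edgeCount G₂ + 1) := by
  classical
  subst hG₁ hG₂
  have hbij := blockLabel_bijective hG hbridge hv₁ hv₂
  let e : C₁.supp ⊕ C₂.supp ≃ V := Equiv.ofBijective _ hbij
  set G₁ : SimpleGraph C₁.supp := C₁.toSimpleGraph
  set G₂ : SimpleGraph C₂.supp := C₂.toSimpleGraph
  have hG₁ : G₁.Connected := C₁.connected_toSimpleGraph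
  have hG₂ : G₂.Connected := C₂.connected_toSimpleGraph
  have hcomap : G.comap e = bridgeSum G₁ G₂ ⟨v₁, hv₁⟩ ⟨v₂, hv₂⟩ :=
    comap_blockLabel hadj hbridge hv₁ hv₂
  have hdeg := degVec_comap e G
  have hF := forestMatrix_comap e G
  have hR := resistanceMatrix_comap e hG
  rw [hcomap] at hdeg hF hR
  have hd : degVec G = hatVec (degVec G₁) + hatVec (degVec G₂) + Pi.single v₁ 1
      + Pi.single v₂ 1 := by
    rw [degVec_bridgeSum] at hdeg
    have hne : ∀ (x : C₁.supp) (y : C₂.supp), (x : V) ≠ y := fun x y h =>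
      Sum.inl_ne_inr (hbij.1 (a₁ := .inl x) (a₂ := .inr y) h)
    funext v
    obtain ⟨x | x, rfl⟩ := e.surjective v
    · have h := congrFun hdeg (.inl x)
      have h2 : (x : V) ∉ C₂.supp := fun h => hne x ⟨x, h⟩ rfl
      have h3 : (x : V) ≠ v₂ := fun h => hne x ⟨v₂, hv₂⟩ h
      rw [Function.comp_apply] at h
      rw [← h]
      change _ = hatVec _ (x : V) + hatVec _ (x : V) + (Pi.single v₁ 1 : V → ℝ) x
        + (Pi.single v₂ 1 : V → ℝ) x
      rw [hatVec_apply, hatVec_apply_of_notMem _ h2]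
      simp [Pi.single_apply, h3, Subtype.ext_iff]
    · have h := congrFun hdeg (.inr x)
      have h2 : (x : V) ∉ C₁.supp := fun h => hne ⟨x, h⟩ x rfl
      have h3 : (x : V) ≠ v₁ := fun h => hne ⟨v₁, hv₁⟩ x h.symm
      rw [Function.comp_apply] at h
      rw [← h]
      change _ = hatVec _ (x : V) + hatVec _ (x : V) + (Pi.single v₁ 1 : V → ℝ) x
        + (Pi.single v₂ 1 : V → ℝ) x
      rw [hatVec_apply, hatVec_apply_of_notMem _ h2]
      simp [Pi.single_apply, h3, Subtype.ext_iff]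
  refine ⟨hd, ?_, ?_, hbij, ?_, ?_, ?_⟩
  -- The edge count follows from the degree formula by the handshake lemma, without describing the
  -- edge set.
  · have h1 := sum_degVec G
    rw [← e.sum_comp] at h1
    have h2 : ∀ i, degVec G (e i) = degVec (bridgeSum G₁ G₂ ⟨v₁, hv₁⟩ ⟨v₂, hv₂⟩) i := fun i =>
      (congrFun hdeg i).symm
    simp only [h2, degVec_bridgeSum, Fintype.sum_sum_type, Sum.elim_inl, Sum.elim_inr,
      Pi.add_apply, Finset.sum_add_distrib, sum_degVec, Finset.sum_pi_single', Finset.mem_univ,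
      if_true] at h1
    have h3 : (edgeCount G : ℝ) = ((edgeCount G₁ + edgeCount G₂ + 1 : ℕ) : ℝ) := by
      push_cast
      linarith
    exact_mod_cast h3
  · rw [← treeCount_comap e G, hcomap, treeCount_bridgeSum]
  · exact hF.symm.trans (forestMatrix_bridgeSum G₁ G₂ _ _)
  · rw [← dotProduct_mulVec_comp_equiv e, ← hF, ← hdeg, forestMatrix_bridgeSum,
      degVec_dotProduct_fromBlocks_mulVec _ _ (fun _ => forestMatrix_comm _ _ _)
        (forestMatrix_self _ _) (fun _ => forestMatrix_comm _ _ _) (forestMatrix_self _ _)]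
  -- The forest identity's block form with both weights `s` and `t` equal to 1.
  · have h := degVec_dotProduct_fromBlocks_mulVec G₁ G₂
      (fun i => resistanceMatrix_comm G₁ ⟨v₁, hv₁⟩ i) (resistanceMatrix_self _ _)
      (fun i => resistanceMatrix_comm G₂ ⟨v₂, hv₂⟩ i) (resistanceMatrix_self _ _) 1 1
    simp only [one_smul, mul_one, one_mul] at h
    rw [← dotProduct_mulVec_comp_equiv e, ← hR, ← hdeg, resistanceMatrix_bridgeSum hG₁ hG₂, h,
      mulVec_single_one, mulVec_single_one]
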